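/- Let $\kappa$ be the Killing form of the Lie algebra $\mathfrak{su}(2)$, let $c\neq 0$ be a real number, and put $\langle x,y\rangle=c\,\kappa(x,y)$ (so $c=1$ gives the Killing form itself, and $c<0$ a positive definite form). For $a=(a_1,a_2,a_3)\in\mathfrak{su}(2)^3$ let $$\Phi(a)=\langle a_1,[a_2,a_3]\rangle ,$$ $$f(a)=\big(\langle a_1,a_2\rangle,\ \langle a_2,a_3\rangle,\ \langle a_3,a_1\rangle,\ \langle a_1,a_1\rangle-\langle a_2,a_2\rangle,\ \langle a_2,a_2\rangle-\langle a_3,a_3\rangle\big)\in\mathbb{R}^5 ,$$ and let $\mathfrak{su}(2)^3_\star$, $\mathfrak{su}(2)^3_+$, $\mathfrak{su}(2)^3_-$ be the open sets $\{\Phi\neq0\}$, $\{\Phi>0\}$, $\{\Phi<0\}$. For $\xi\in\mathfrak{su}(2)$ let $l^j_\xi(a)=\langle\xi,a_j\rangle$, and let $\pi_1$ be the bivector field on $\mathfrak{su}(2)^3_\star$ with the brackets $$\{l^1_\xi,l^1_\zeta\}=l^1_{[\xi,\zeta]},\quad \{l^1_\xi,l^2_\zeta\}=\{l^2_\xi,l^1_\zeta\}=l^2_{[\xi,\zeta]},\quad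 \{l^1_\xi,l^3_\zeta\}=\{l^3_\xi,l^1_\zeta\}=l^3_{[\xi,\zeta]},$$ $$\{l^2_\xi,l^2_\zeta\}=\{l^3_\xi,l^3_\zeta\}=-l^1_{[\xi,\zeta]},\quad \{l^2_\xi,l^3_\zeta\}=-\{l^3_\xi,l^2_\zeta\}=A_{\xi,\zeta},$$ where $$A_{\xi,\zeta}(a)=\frac1{\Phi(a)}\sum_{(i,j)\in\{(1,2),(2,3),(3,1)\}}\langle\xi,[a_i,a_j]\rangle\langle\zeta,[a_i,a_j]\rangle .$$ A symplectic leaf of $\pi_1$ is a maximal connected (immersed) integral submanifold of the distribution $\pi_1^\sharp(T^*\mathfrak{su}(2)^3_\star)$, that is, one that contains every connected integral submanifold meeting it. Theorem. For every $\eta\in\mathfrak{su}(2)^3_+$, the symplectic leaf of $\pi_1$ through $\eta$ exists, is unique, and is equal to $f^{-1}(f(\eta))\cap\mathfrak{su}(2)^3_+$. For every $\eta\in\mathfrak{su}(2)^3_-$, the symplectic leaf of $\pi_1$ through $\eta$ exists, is unique, and is equal to $f^{-1}(f(\eta))\cap\mathfrak{su}(2)^3_-$. In particular all these sets are connected. 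-/

import Mathlib

open scoped Manifold ContDiff

noncomputable section

namespace HyperLie

/-! ### The Lie algebra `su(2)` -/

attribute [local instance] LieRing.ofAssociativeRing

/-- `su(2)`: the real Lie algebra of trace-free skew-Hermitian complex `2 × 2` matrices, with the
commutator bracket. -/
def su2 : LieSubalgebra ℝ (Matrix (Fin 2) (Fin 2) ℂ) where
  carrier := {X | X.conjTranspose = -X ∧ X.trace = 0}
  zero_mem' := by simp
  add_mem' := by
    rintro X Y ⟨hX, hX'⟩ ⟨hY, hY'⟩
    refine ⟨?_, by rw [Matrix.trace_add, hX', hY', add_zero]⟩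
    rw [Matrix.conjTranspose_add, hX, hY]; abel
  smul_mem' := by
    rintro r X ⟨hX, hX'⟩
    refine ⟨?_, by rw [Matrix.trace_smul, hX', smul_zero]⟩
    rw [Matrix.conjTranspose_smul, hX]; simp
  lie_mem' := by
    rintro X Y ⟨hX, -⟩ ⟨hY, -⟩
    refine ⟨?_, ?_⟩
    · rw [Ring.lie_def, Matrix.conjTranspose_sub, Matrix.conjTranspose_mul,
        Matrix.conjTranspose_mul, hX, hY]
      noncomm_ring
    · rw [Ring.lie_def, Matrix.trace_sub, Matrix.trace_mul_comm, sub_self]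

/-- The norm on `su(2)` induced by the entrywise supremum norm of matrices; it only serves to make
the finite-dimensional space `su(2)` a smooth manifold. -/
instance : NormedAddCommGroup su2 :=
  letI : NormedAddCommGroup (Matrix (Fin 2) (Fin 2) ℂ) := Matrix.normedAddCommGroup
  NormedAddCommGroup.induced su2 (Matrix (Fin 2) (Fin 2) ℂ) su2.incl.toLinearMap
    Subtype.val_injective

instance : NormedSpace ℝ su2 :=
  letI : NormedAddCommGroup (Matrix (Fin 2) (Fin 2) ℂ) := Matrix.normedAddCommGroup
  letI : NormedSpace ℝ (Matrix (Fin 2) (Fin 2) ℂ) := Matrix.normedSpace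
  NormedSpace.induced ℝ su2 (Matrix (Fin 2) (Fin 2) ℂ) su2.incl.toLinearMap

/-- Linear coordinates on `su(2)`: `(x, y, z)` corresponds to the matrix with rows
`(i z, x + i y)` and `(-x + i y, -i z)`. -/
def coord : su2 ≃ₗ[ℝ] (Fin 3 → ℝ) where
  toFun X := ![(X.1 0 1).re, (X.1 0 1).im, (X.1 0 0).im]
  map_add' X Y := by ext i; fin_cases i <;> simp
  map_smul' r X := by ext i; fin_cases i <;> simp
  invFun v := ⟨!![⟨0, v 2⟩, ⟨v 0, v 1⟩; ⟨-v 0, v 1⟩, ⟨0, -v 2⟩], by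
    refine ⟨?_, ?_⟩
    · ext i j; fin_cases i <;> fin_cases j <;> simp [Complex.ext_iff]
    · simp [Matrix.trace_fin_two, Complex.ext_iff]⟩
  left_inv := by
    rintro ⟨X, hX, hX'⟩
    have h00 := congrFun (congrFun hX 0) 0
    have h10 := congrFun (congrFun hX 1) 0
    rw [Matrix.trace_fin_two] at hX'
    simp [Complex.ext_iff] at h00 h10 hX'
    ext i j
    fin_cases i <;> fin_cases j <;> simp [Complex.ext_iff] <;> (try constructor) <;> linarith
  right_inv v := by ext i; fin_cases i <;> simp

instance : Module.Finite ℝ su2 := Module.Finite.equiv coord.symm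

theorem coord_lie (X Y : su2) : coord ⁅X, Y⁆ = (2 : ℝ) •
    ![coord X 1 * coord Y 2 - coord X 2 * coord Y 1, coord X 2 * coord Y 0 - coord X 0 * coord Y 2,
      coord X 0 * coord Y 1 - coord X 1 * coord Y 0] := by
  obtain ⟨v, rfl⟩ := coord.symm.surjective X
  obtain ⟨w, rfl⟩ := coord.symm.surjective Y
  simp only [LinearEquiv.apply_symm_apply]
  ext i
  fin_cases i <;> simp [coord, Ring.lie_def] <;> ring

theorem killingForm_eq (X Y : su2) : killingForm ℝ su2 X Y =
    -8 * (coord X 0 * coord Y 0 + coord X 1 * coord Y 1 + coord X 2 * coord Y 2) := by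
  rw [killingForm_apply_apply,
    LinearMap.trace_eq_matrix_trace ℝ (Module.Basis.ofEquivFun coord)]
  simp [Matrix.trace, Fin.sum_univ_three, LinearMap.toMatrix_apply, coord_lie, Pi.single_apply]
  ring

instance : LieAlgebra.IsKilling ℝ su2 where
  killingCompl_top_eq_bot := by
    refine (LieSubmodule.toSubmodule_eq_bot _).mp
      ((LieIdeal.coe_killingCompl_top ℝ su2).trans (LinearMap.ker_eq_bot'.mpr ?_))
    intro X hX
    have h (i : Fin 3) : coord X i = 0 := by
      have := LinearMap.congr_fun hX (coord.symm (Pi.single i 1))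
      rw [killingForm_eq] at this
      fin_cases i <;> simpa using this
    exact coord.map_eq_zero_iff.mp (funext h)

/-! ### The triple product, the Casimir functions, and the bivector field -/

/-- The ambient vector space `su(2)³`; the components `a₁, a₂, a₃` of `a` are `a 0, a 1, a 2`. -/
abbrev Triple : Type := Fin 3 → su2

/-- The invariant form `⟨x, y⟩ = c κ(x, y)`, a multiple of the Killing form `κ` of `su(2)`. -/
def form (c : ℝ) : LinearMap.BilinForm ℝ su2 := c • killingForm ℝ su2

/-- `Φ(a₁, a₂, a₃) = ⟨a₁, [a₂, a₃]⟩`. -/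
def Phi (c : ℝ) (a : Triple) : ℝ := form c (a 0) ⁅a 1, a 2⁆

/-- The domain `su(2)³⋆ = {Φ ≠ 0}` of the bivector field. -/
def starSet (c : ℝ) : Set Triple := {a | Phi c a ≠ 0}

/-- The map `f = (f₁, …, f₅)` of Casimir functions. -/
def casimir (c : ℝ) (a : Triple) : Fin 5 → ℝ :=
  ![form c (a 0) (a 1), form c (a 1) (a 2), form c (a 2) (a 0),
    form c (a 0) (a 0) - form c (a 1) (a 1), form c (a 1) (a 1) - form c (a 2) (a 2)]

/-- The bilinear form `(ξ, ζ) ↦ ⟨[ξ, ζ], x⟩`; for `x = a j` it is `l^j_{[ξ, ζ]}` evaluated at `a`. -/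
def lieForm (c : ℝ) (x : su2) : LinearMap.BilinForm ℝ su2 :=
  LinearMap.mk₂ ℝ (fun ξ ζ => form c ⁅ξ, ζ⁆ x) (by simp) (by simp) (by simp) (by simp)

/-- The contraction `(ξ, ζ) ↦ ⟨ξ, u⟩ ⟨ζ, u⟩` of the symmetric tensor `u ⊗ u`. -/
def sqForm (c : ℝ) (u : su2) : LinearMap.BilinForm ℝ su2 :=
  LinearMap.BilinForm.linMulLin (form c u) (form c u)

/-- The contraction `(ξ, ζ) ↦ A_{ξ, ζ}(a)` of the tensor
`A = Φ⁻¹ ([a₁,a₂] ⊗ [a₁,a₂] + [a₂,a₃] ⊗ [a₂,a₃] + [a₃,a₁] ⊗ [a₃,a₁])`. -/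
def tensorA (c : ℝ) (a : Triple) : LinearMap.BilinForm ℝ su2 :=
  (Phi c a)⁻¹ • (sqForm c ⁅a 0, a 1⁆ + sqForm c ⁅a 1, a 2⁆ + sqForm c ⁅a 2, a 0⁆)

/-- The table of brackets: `bracketTable c a j k ξ ζ` is the value at `a` of
`{l^j_ξ, l^k_ζ}`, where `l^j_ξ(a) = ⟨ξ, a j⟩`. -/
def bracketTable (c : ℝ) (a : Triple) : Fin 3 → Fin 3 → LinearMap.BilinForm ℝ su2 :=
  ![![lieForm c (a 0), lieForm c (a 1), lieForm c (a 2)],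
    ![lieForm c (a 1), -lieForm c (a 0), tensorA c a],
    ![lieForm c (a 2), -tensorA c a, -lieForm c (a 0)]]

/-- The linear function `l^j_ξ(a) = ⟨ξ, a j⟩` on `su(2)³` (which is its own differential). -/
def linFun (c : ℝ) (j : Fin 3) (ξ : su2) : Module.Dual ℝ Triple :=
  form c ξ ∘ₗ LinearMap.proj j

/-- The `j`-th component `ξ_j ∈ su(2)` of a covector `α = ∑ⱼ l^j_{ξ_j}` on `su(2)³` (for `c ≠ 0`):
the element that represents `x ↦ α (0, …, x, …, 0)` with respect to `⟨·, ·⟩`. -/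
def grad (c : ℝ) (j : Fin 3) : Module.Dual ℝ Triple →ₗ[ℝ] su2 :=
  c⁻¹ • ((killingForm ℝ su2).toDual
    (LieAlgebra.IsKilling.killingForm_nondegenerate ℝ su2)).symm.toLinearMap ∘ₗ
      (LinearMap.single ℝ (fun _ : Fin 3 => su2) j).dualMap

theorem grad_linFun {c : ℝ} (hc : c ≠ 0) (j k : Fin 3) (ξ : su2) :
    grad c j (linFun c k ξ) = if j = k then ξ else 0 := by
  have key : linFun c k ξ ∘ₗ LinearMap.single ℝ (fun _ : Fin 3 => su2) j =
      (killingForm ℝ su2).toDual (LieAlgebra.IsKilling.killingForm_nondegenerate ℝ su2)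
        (if j = k then c • ξ else 0) := by
    ext x
    by_cases h : j = k
    · subst h; simp [linFun, form, LinearMap.BilinForm.toDual_def]
    · simp [linFun, h, Ne.symm h]
  simp only [grad, LinearMap.smul_apply, LinearMap.comp_apply, LinearMap.dualMap_apply',
    LinearEquiv.coe_coe]
  rw [key, LinearEquiv.symm_apply_apply]
  split_ifs <;> simp [hc]

/-- The bivector field `π₁` on `su(2)³⋆`, as a bilinear form on covectors: the one whose brackets of
the functions `l^j_ξ` are given by the table, see `pi1_linFun`. -/
def pi1 (c : ℝ) (a : Triple) : LinearMap.BilinForm ℝ (Module.Dual ℝ Triple) :=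
  ∑ j, ∑ k, (bracketTable c a j k).comp (grad c j) (grad c k)

theorem pi1_linFun {c : ℝ} (hc : c ≠ 0) (a : Triple) (j k : Fin 3) (ξ ζ : su2) :
    pi1 c a (linFun c j ξ) (linFun c k ζ) = bracketTable c a j k ξ ζ := by
  simp only [pi1, LinearMap.sum_apply, LinearMap.BilinForm.comp_apply, grad_linFun hc]
  rw [Finset.sum_eq_single j (by intro i _ h; simp [h]) (by simp),
    Finset.sum_eq_single k (by intro i _ h; simp [h]) (by simp)]
  simp

theorem pi1_isAlt (c : ℝ) (a : Triple) : (pi1 c a).IsAlt := by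
  intro α
  have h (x ξ ζ : su2) : lieForm c x ζ ξ = -lieForm c x ξ ζ := by
    simp only [lieForm, LinearMap.mk₂_apply]
    rw [← lie_skew ζ ξ, map_neg, LinearMap.neg_apply]
  have h0 (x ξ : su2) : lieForm c x ξ ξ = 0 := by simp [lieForm]
  have hA (ξ ζ : su2) : tensorA c a ζ ξ = tensorA c a ξ ζ := by
    simp [tensorA, sqForm, mul_comm]
  simp [pi1, bracketTable, Fin.sum_univ_three, h0, h _ (grad c 0 α) (grad c 1 α),
    h _ (grad c 0 α) (grad c 2 α), hA (grad c 1 α) (grad c 2 α)]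
  ring

/-! ### Symplectic leaves -/

/-- The distribution `π♯(T*M)` of a bivector field `π` on (an open subset of) a vector space `E`:
its value at `a` is the set of tangent vectors `v` such that, for some covector `α`, `β v = π(α, β)`
for all covectors `β`. -/
def sympDistribution {E : Type} [AddCommGroup E] [Module ℝ E]
    (π : E → LinearMap.BilinForm ℝ (Module.Dual ℝ E)) (a : E) : Submodule ℝ E :=
  (LinearMap.range (π a)).comap (Module.Dual.eval ℝ E)

/-- `L` is a connected integral submanifold of the distribution `D` on the open set `U`: it is the
image of an injective smooth immersion `ι : S → U` of a connected smooth manifold `S`, whose tangent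
spaces are the spaces of `D`. (So `L` is an immersed submanifold; its manifold topology may be finer
than the subspace topology.) -/
def IsConnectedIntegralSubmanifold {E : Type} [NormedAddCommGroup E] [NormedSpace ℝ E]
    (U : Set E) (D : E → Submodule ℝ E) (L : Set E) : Prop :=
  ∃ (n : ℕ) (S : Type) (_ : TopologicalSpace S) (_ : ChartedSpace (EuclideanSpace ℝ (Fin n)) S)
    (ι : S → E),
    T2Space S ∧ SecondCountableTopology S ∧ ConnectedSpace S ∧ IsManifold (𝓡 n) ∞ S ∧
    ContMDiff (𝓡 n) 𝓘(ℝ, E) ∞ ι ∧ Function.Injective ι ∧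
    (∀ s, Function.Injective (mfderiv (𝓡 n) 𝓘(ℝ, E) ι s)) ∧
    (∀ s, Set.range (mfderiv (𝓡 n) 𝓘(ℝ, E) ι s) = (D (ι s) : Set E)) ∧
    (∀ s, ι s ∈ U) ∧ Set.range ι = L

/-- `L` is a symplectic leaf of the bivector field `π` on the open set `U`: a maximal connected
integral submanifold of the distribution `π♯(T*U)`, that is, one that contains every connected
integral submanifold that meets it. -/
def IsSymplecticLeaf {E : Type} [NormedAddCommGroup E] [NormedSpace ℝ E] (U : Set E)
    (π : E → LinearMap.BilinForm ℝ (Module.Dual ℝ E)) (L : Set E) : Prop :=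
  IsConnectedIntegralSubmanifold U (sympDistribution π) L ∧
    ∀ L', IsConnectedIntegralSubmanifold U (sympDistribution π) L' → (L' ∩ L).Nonempty → L' ⊆ L

end HyperLie

end

open scoped Topology
open Set

noncomputable section

/-! Where `Φ ≠ 0` the entries of `a` form a basis of `su(2)`, so a tangent vector `v` is determined
by the 3 × 3 matrix of pairings `⟨a_i, v_k⟩`. Solving the linear system given by the bracket table
shows that `v` lies in the distribution of `π₁` exactly when this matrix is skew plus a multiple of
the identity, and this is the equation `df(v) = 0` (`mem_sympDistribution_iff_casimirDeriv`).
Moreover `df` is onto `ℝ⁵` (`casimirDeriv_surjective`), so level sets of `f` are 4-dimensional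
integral submanifolds once they are known to be connected. Conversely `f` is constant on every
connected integral submanifold and `Φ` keeps its sign there, which gives maximality without any
foliation theory.

Connectedness is the remaining point. With `M` the coordinate matrix of `a` and `G` the Gram matrix
of `η`, fixing `f` means `M Mᵀ = G + s • 1` for some real `s`, and the sign of `Φ` fixes that of
`det M`. For `det M > 0`, polar decomposition gives `M = √(G + s) R` with `R` a rotation, `s` in an
open half-line and `R` given by Euler angles: a continuous image of a convex set
(`isPreconnected_gram`). -/

namespace HyperLie

/-! ### Regular level sets as immersed submanifolds. -/

section LevelSet

variable {E F H : Type*} [NormedAddCommGroup E] [NormedSpace ℝ E] [FiniteDimensional ℝ E]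
  [NormedAddCommGroup F] [NormedSpace ℝ F] [FiniteDimensional ℝ F]
  [NormedAddCommGroup H] [NormedSpace ℝ H] [FiniteDimensional ℝ H]

/-- A surjective linear map to `F` is completed to a linear equivalence with `F × H`. -/
theorem exists_equiv_prod_of_surjective (A : E →L[ℝ] F) (hA : Function.Surjective A)
    (hdim : Module.finrank ℝ E = Module.finrank ℝ F + Module.finrank ℝ H) :
    ∃ p : E →L[ℝ] H, ∃ e : E ≃L[ℝ] F × H, (e : E →L[ℝ] F × H) = A.prod p := by
  obtain ⟨W, hW⟩ := Submodule.exists_isCompl (LinearMap.ker (A : E →ₗ[ℝ] F))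
  have hker : Module.finrank ℝ (LinearMap.ker (A : E →ₗ[ℝ] F)) = Module.finrank ℝ H := by
    have h := LinearMap.finrank_range_add_finrank_ker (A : E →ₗ[ℝ] F)
    rw [LinearMap.range_eq_top.mpr hA, finrank_top] at h
    omega
  let i := LinearEquiv.ofFinrankEq _ _ hker
  let p : E →ₗ[ℝ] H := i.toLinearMap ∘ₗ Submodule.projectionOnto _ _ hW
  have hinj : Function.Injective ((A : E →ₗ[ℝ] F).prod p) := by
    -- On the kernel of `A` the map `p` is the isomorphism `i`, so nothing nonzero is killed by
    -- both.
    rw [← LinearMap.ker_eq_bot, LinearMap.ker_eq_bot']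
    intro x hx
    have h1 : x ∈ LinearMap.ker (A : E →ₗ[ℝ] F) := congrArg Prod.fst hx
    have h2 : p x = 0 := congrArg Prod.snd hx
    have h3 : p x = i ⟨x, h1⟩ := by
      simp only [p, LinearMap.comp_apply, LinearEquiv.coe_coe]
      congr 1
      exact Submodule.projectionOnto_apply_left hW ⟨x, h1⟩
    rw [h3, LinearEquiv.map_eq_zero_iff] at h2
    exact congrArg Subtype.val h2
  refine ⟨LinearMap.toContinuousLinearMap p,
    (LinearEquiv.ofInjectiveOfFinrankEq _ hinj (by simp [hdim])).toContinuousLinearEquiv, ?_⟩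
  ext x <;> rfl

/-- Near a regular point, a smooth map is the first component of a smooth coordinate system whose
second component is linear. -/
theorem exists_straightening {f : E → F} (hf : ContDiff ℝ ∞ f) {U : Set E} (hU : IsOpen U)
    {a : E} (ha : a ∈ U) (hsurj : Function.Surjective (fderiv ℝ f a))
    (hdim : Module.finrank ℝ E = Module.finrank ℝ F + Module.finrank ℝ H) :
    ∃ (Ψ : OpenPartialHomeomorph E (F × H)) (p : E →L[ℝ] H), a ∈ Ψ.source ∧ Ψ.source ⊆ U ∧
      (∀ x, Ψ x = (f x, p x)) ∧ ContDiffOn ℝ ∞ Ψ.symm Ψ.target := by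
  obtain ⟨p, e, he⟩ := exists_equiv_prod_of_surjective (H := H) _ hsurj hdim
  let φ : E → F × H := fun x => (f x, p x)
  have hφ : ContDiff ℝ ∞ φ := hf.prodMk p.contDiff
  have hφ' (x : E) : HasFDerivAt φ ((fderiv ℝ f x).prod p) x :=
    ((hf.differentiable (by simp)) x).hasFDerivAt.prodMk p.hasFDerivAt
  have hfa : HasFDerivAt φ (e : E →L[ℝ] F × H) a := he ▸ hφ' a
  -- The open set where the derivative stays invertible; restricting to it makes the inverse smooth
  -- on the whole target, not only at the image of `a`.
  let V : Set E := (fun x => (fderiv ℝ f x).prod p) ⁻¹'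
    range ((↑) : (E ≃L[ℝ] F × H) → (E →L[ℝ] F × H))
  have hV : IsOpen V := by
    have hc : Continuous fun x => (fderiv ℝ φ x) := hφ.continuous_fderiv (by simp)
    have : (fun x => (fderiv ℝ f x).prod p) = fun x => fderiv ℝ φ x :=
      funext fun x => (hφ' x).fderiv.symm
    simp only [V, this]
    exact ContinuousLinearEquiv.isOpen.preimage hc
  let Ψ₀ := hφ.contDiffAt.toOpenPartialHomeomorph (a := a) φ hfa (by simp)
  have hΨ₀ : ∀ x, Ψ₀ x = φ x := fun x => rfl
  refine ⟨Ψ₀.restrOpen (U ∩ V) (hU.inter hV), p, ⟨?_, ha, e, he⟩, fun x hx => hx.2.1,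
    fun x => rfl, ?_⟩
  · exact hφ.contDiffAt.mem_toOpenPartialHomeomorph_source hfa (by simp)
  · intro z hz
    set Ψ := Ψ₀.restrOpen (U ∩ V) (hU.inter hV)
    obtain ⟨e', he'⟩ := (Ψ.map_target hz).2.2
    exact (Ψ.contDiffAt_symm hz (f₀' := e') (he' ▸ hφ' _) hφ.contDiffAt).contDiffWithinAt

end LevelSet

section LevelChart

variable {E F H : Type*} [TopologicalSpace E] [TopologicalSpace F] [TopologicalSpace H]

/-- The chart of a level set given by a coordinate system that straightens it. -/
def levelChart {f : E → F} {U : Set E} {y : F} (Ψ : OpenPartialHomeomorph E (F × H))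
    (hΨU : Ψ.source ⊆ U) (hΨ : ∀ x, (Ψ x).1 = f x) (a : ↥(U ∩ f ⁻¹' {y})) :
    OpenPartialHomeomorph ↥(U ∩ f ⁻¹' {y}) H where
  toFun x := (Ψ x).2
  -- The default value `a` is only taken off the target, where it plays no role.
  invFun z := open Classical in
    if h : Ψ.symm (y, z) ∈ U ∩ f ⁻¹' {y} then ⟨Ψ.symm (y, z), h⟩ else a
  source := Subtype.val ⁻¹' Ψ.source
  target := (fun z => (y, z)) ⁻¹' Ψ.target
  map_source' x hx := by
    have h1 : (y, (Ψ x).2) = Ψ x := Prod.ext (by rw [hΨ]; exact x.2.2.symm) rfl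
    change (y, (Ψ x).2) ∈ Ψ.target
    rw [h1]
    exact Ψ.map_source hx
  map_target' z hz := by
    have h : Ψ.symm (y, z) ∈ U ∩ f ⁻¹' {y} :=
      ⟨hΨU (Ψ.map_target hz), by rw [mem_preimage, ← hΨ, Ψ.right_inv hz]; rfl⟩
    rw [dif_pos h]
    exact Ψ.map_target hz
  left_inv' x hx := by
    have h1 : (y, (Ψ x).2) = Ψ x := Prod.ext (by rw [hΨ]; exact x.2.2.symm) rfl
    have h2 : Ψ.symm (y, (Ψ x).2) = x := by rw [h1]; exact Ψ.left_inv hx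
    rw [dif_pos (by rw [h2]; exact x.2)]
    exact Subtype.ext h2
  right_inv' z hz := by
    have h : Ψ.symm (y, z) ∈ U ∩ f ⁻¹' {y} :=
      ⟨hΨU (Ψ.map_target hz), by rw [mem_preimage, ← hΨ, Ψ.right_inv hz]; rfl⟩
    rw [dif_pos h]
    exact congrArg Prod.snd (Ψ.right_inv hz)
  open_source := Ψ.open_source.preimage continuous_subtype_val
  open_target := Ψ.open_target.preimage (by fun_prop)
  continuousOn_toFun := continuous_snd.comp_continuousOn
    (Ψ.continuousOn.comp continuous_subtype_val.continuousOn fun _ h => h)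
  continuousOn_invFun := by
    rw [Topology.IsInducing.subtypeVal.continuousOn_iff]
    refine (Ψ.continuousOn_symm.comp (f := fun z => (y, z)) (by fun_prop)
      fun _ h => h).congr fun z hz => ?_
    have h : Ψ.symm (y, z) ∈ U ∩ f ⁻¹' {y} :=
      ⟨hΨU (Ψ.map_target hz), by rw [mem_preimage, ← hΨ, Ψ.right_inv hz]; rfl⟩
    simp only [Function.comp_apply]
    rw [dif_pos h]

theorem levelChart_symm_val {f : E → F} {U : Set E} {y : F}
    {Ψ : OpenPartialHomeomorph E (F × H)} (hΨU : Ψ.source ⊆ U) (hΨ : ∀ x, (Ψ x).1 = f x)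
    (a : ↥(U ∩ f ⁻¹' {y})) {z : H} (hz : (y, z) ∈ Ψ.target) :
    (((levelChart Ψ hΨU hΨ a).symm z : ↥(U ∩ f ⁻¹' {y})) : E) = Ψ.symm (y, z) := by
  have h : Ψ.symm (y, z) ∈ U ∩ f ⁻¹' {y} :=
    ⟨hΨU (Ψ.map_target hz), by rw [mem_preimage, ← hΨ, Ψ.right_inv hz]; rfl⟩
  classical
  change Subtype.val (dite _ _ _) = _
  rw [dif_pos h]

end LevelChart

/-- A connected regular level set is a connected integral submanifold of the distribution of the
kernels of the derivative. -/
theorem isConnectedIntegralSubmanifold_level {E : Type} {F : Type*} [NormedAddCommGroup E]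
    [NormedSpace ℝ E] [FiniteDimensional ℝ E] [NormedAddCommGroup F] [NormedSpace ℝ F]
    [FiniteDimensional ℝ F] {n : ℕ} (hdim : Module.finrank ℝ E = Module.finrank ℝ F + n)
    {f : E → F} (hf : ContDiff ℝ ∞ f) {U : Set E} (hU : IsOpen U) {U' : Set E} (hUU' : U ⊆ U')
    (y : F) (hsurj : ∀ a ∈ U, Function.Surjective (fderiv ℝ f a))
    (D : E → Submodule ℝ E) (hD : ∀ a ∈ U, ∀ v, v ∈ D a ↔ fderiv ℝ f a v = 0)
    (hconn : IsConnected (U ∩ f ⁻¹' {y})) :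
    IsConnectedIntegralSubmanifold U' D (U ∩ f ⁻¹' {y}) := by
  have key (a : ↥(U ∩ f ⁻¹' {y})) := exists_straightening (H := EuclideanSpace ℝ (Fin n)) hf hU
    a.2.1 (hsurj a a.2.1) (by simpa using hdim)
  choose Ψ p haΨ hΨU hΨ hsm using key
  have hΨ1 (a) : ∀ x, (Ψ a x).1 = f x := fun x => by rw [hΨ]
  let C (a : ↥(U ∩ f ⁻¹' {y})) := levelChart (Ψ a) (hΨU a) (hΨ1 a) a
  have hCs (a) {z} (hz : (y, z) ∈ (Ψ a).target) :
      (((C a).symm z : ↥(U ∩ f ⁻¹' {y})) : E) = (Ψ a).symm (y, z) :=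
    levelChart_symm_val _ _ a hz
  have hCp (a) (x) : C a x = p a x := congrArg Prod.snd (hΨ a x)
  have hCm (a) : ContDiffOn ℝ ∞ (fun z => (((C a).symm z : ↥(U ∩ f ⁻¹' {y})) : E))
      (C a).target := by
    refine ((hsm a).comp (f := fun z => (y, z)) (by fun_prop) fun _ h => h).congr
      fun z hz => hCs a hz
  let cs : ChartedSpace (EuclideanSpace ℝ (Fin n)) ↥(U ∩ f ⁻¹' {y}) :=
    { atlas := range C
      chartAt := C
      mem_chart_source := fun a => haΨ a
      chart_mem_atlas := fun a => mem_range_self a }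
  have hder (s : ↥(U ∩ f ⁻¹' {y})) : ContDiffAt ℝ ∞
      (fun z => (((C s).symm z : ↥(U ∩ f ⁻¹' {y})) : E)) (C s s) :=
    (hCm s).contDiffAt ((C s).open_target.mem_nhds ((C s).map_source (haΨ s)))
  have hmf (s : ↥(U ∩ f ⁻¹' {y})) : HasMFDerivAt (𝓡 n) 𝓘(ℝ, E)
      (Subtype.val : ↥(U ∩ f ⁻¹' {y}) → E) s
      (fderiv ℝ (fun z => (((C s).symm z : ↥(U ∩ f ⁻¹' {y})) : E)) (C s s)) := by
    refine ⟨continuous_subtype_val.continuousAt, ?_⟩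
    have := ((hder s).differentiableAt (by simp)).hasFDerivAt
    simp only [mfld_simps]
    exact this.hasFDerivWithinAt
  have hrange (s : ↥(U ∩ f ⁻¹' {y})) :
      Function.Injective (mfderiv (𝓡 n) 𝓘(ℝ, E) (Subtype.val : ↥(U ∩ f ⁻¹' {y}) → E) s) ∧
      range (mfderiv (𝓡 n) 𝓘(ℝ, E) (Subtype.val : ↥(U ∩ f ⁻¹' {y}) → E) s) =
        (D s : Set E) := by
    rw [(hmf s).mfderiv]
    set G := fderiv ℝ (fun z => (((C s).symm z : ↥(U ∩ f ⁻¹' {y})) : E)) (C s s)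
    have hG : HasFDerivAt (fun z => (((C s).symm z : ↥(U ∩ f ⁻¹' {y})) : E)) G (C s s) :=
      ((hder s).differentiableAt (by simp)).hasFDerivAt
    have hval : (((C s).symm (C s s) : ↥(U ∩ f ⁻¹' {y})) : E) = s := by
      rw [(C s).left_inv (haΨ s)]
    -- The chart is the restriction of the linear map `p s`, so `p s` is a left inverse of `G`; this
    -- yields injectivity.
    have h1 : (p s).comp G = ContinuousLinearMap.id ℝ _ := by
      refine ((p s).hasFDerivAt.comp _ hG).unique ((hasFDerivAt_id _).congr_of_eventuallyEq ?_)
      filter_upwards [(C s).open_target.mem_nhds ((C s).map_source (haΨ s))] with z hz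
      simp only [Function.comp_apply, id]
      rw [← hCp, (C s).right_inv hz]
    have h2 : (fderiv ℝ f s).comp G = 0 := by
      have hfd := ((hf.differentiable (by simp)) s).hasFDerivAt
      have hfd' : HasFDerivAt f (fderiv ℝ f s)
        (((C s).symm (C s s) : ↥(U ∩ f ⁻¹' {y})) : E) := by rw [hval]; exact hfd
      refine (HasFDerivAt.comp (f := fun z => (((C s).symm z : ↥(U ∩ f ⁻¹' {y})) : E)) _
        hfd' hG).unique ?_
      have : (f ∘ fun z => (((C s).symm z : ↥(U ∩ f ⁻¹' {y})) : E)) = fun _ => y :=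
        funext fun z => ((C s).symm z).2.2
      rw [this]
      exact hasFDerivAt_const _ _
    have hinj : Function.Injective G := fun v w h => by
      have hv := DFunLike.congr_fun h1 v
      have hw := DFunLike.congr_fun h1 w
      simp only [ContinuousLinearMap.comp_apply, ContinuousLinearMap.id_apply] at hv hw
      rw [← hv, ← hw, h]
    refine ⟨hinj, ?_⟩
    have hle : LinearMap.range (G : EuclideanSpace ℝ (Fin n) →ₗ[ℝ] E) ≤
        LinearMap.ker (fderiv ℝ f s : E →ₗ[ℝ] F) := by
      rintro _ ⟨v, rfl⟩
      exact DFunLike.congr_fun h2 v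
    -- Both spaces have dimension `n`, so the inclusion is an equality.
    have heq := Submodule.eq_of_le_of_finrank_eq hle (by
      have h3 := LinearMap.finrank_range_add_finrank_ker (fderiv ℝ f s : E →ₗ[ℝ] F)
      rw [LinearMap.range_eq_top.mpr (hsurj s s.2.1), finrank_top] at h3
      rw [LinearMap.finrank_range_of_inj hinj, finrank_euclideanSpace_fin]
      omega)
    ext v
    have := SetLike.ext_iff.mp heq v
    exact this.trans (hD s s.2.1 v).symm
  refine ⟨n, ↥(U ∩ f ⁻¹' {y}), inferInstance, cs, Subtype.val, inferInstance, ?_,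
    isConnected_iff_connectedSpace.mp hconn, ?_, ?_, Subtype.val_injective,
    fun s => (hrange s).1, fun s => (hrange s).2, fun s => hUU' s.2.1, Subtype.range_coe⟩
  · have : SecondCountableTopology E := by
      have : ProperSpace E := FiniteDimensional.proper ℝ E
      infer_instance
    infer_instance
  · apply isManifold_of_contDiffOn
    rintro _ _ ⟨a, rfl⟩ ⟨b, rfl⟩
    simp only [mfld_simps]
    -- A transition map is a linear map applied to a smooth `E`-valued parametrization, hence
    -- smooth.
    have : ((C b) ∘ (C a).symm) =
        fun z => p b (((C a).symm z : ↥(U ∩ f ⁻¹' {y})) : E) := funext fun z => hCp b _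
    rw [this]
    exact ((p b).contDiff.comp_contDiffOn (hCm a)).mono inter_subset_left
  · intro s
    rw [contMDiffAt_iff]
    refine ⟨continuous_subtype_val.continuousAt, ?_⟩
    simp only [mfld_simps]
    exact (hder s).contDiffWithinAt

/-! ### First integrals on connected integral submanifolds. -/

/-- A differentiable map with zero derivative on a connected manifold is constant. -/
theorem eq_of_mfderiv_eq_zero {n : ℕ} {S F : Type*} [TopologicalSpace S] [ConnectedSpace S]
    [ChartedSpace (EuclideanSpace ℝ (Fin n)) S] [IsManifold (𝓡 n) ∞ S]
    [NormedAddCommGroup F] [NormedSpace ℝ F] {g : S → F}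
    (hg : MDifferentiable (𝓡 n) 𝓘(ℝ, F) g) (h0 : ∀ s, mfderiv (𝓡 n) 𝓘(ℝ, F) g s = 0)
    (s t : S) : g s = g t := by
  suffices IsLocallyConstant g from this.apply_eq_of_isPreconnected isPreconnected_univ trivial trivial
  rw [IsLocallyConstant.iff_eventually_eq]
  intro x
  have : IsManifold (𝓡 n) 1 S := IsManifold.of_le (n := ∞) (by simp)
  let e := chartAt (EuclideanSpace ℝ (Fin n)) x
  have hxe : x ∈ e.source := mem_chart_source _ x
  have hd (z) (hz : z ∈ e.target) : HasFDerivAt (g ∘ e.symm) (0 : _ →L[ℝ] F) z := by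
    have h1 := (hg (e.symm z)).hasMFDerivAt
    rw [h0] at h1
    have h2 := (mdifferentiableAt_atlas_symm (I := 𝓡 n) (chart_mem_atlas _ x) hz).hasMFDerivAt
    have h3 := HasMFDerivAt.comp z h1 h2
    rw [ContinuousLinearMap.zero_comp] at h3
    exact h3.hasFDerivAt
  obtain ⟨r, hr, hball⟩ := Metric.isOpen_iff.mp e.open_target _ (e.map_source hxe)
  have hnhds : e.source ∩ e ⁻¹' Metric.ball (e x) r ∈ 𝓝 x :=
    (e.isOpen_inter_preimage Metric.isOpen_ball).mem_nhds ⟨hxe, Metric.mem_ball_self hr⟩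
  filter_upwards [hnhds] with w hw
  have := (convex_ball (e x) r).is_const_of_fderivWithin_eq_zero (𝕜 := ℝ) (f := g ∘ e.symm)
    (fun z hz => (hd z (hball hz)).differentiableAt.differentiableWithinAt)
    (fun z hz => by
      rw [fderivWithin_of_isOpen Metric.isOpen_ball hz, (hd z (hball hz)).fderiv])
    hw.2 (Metric.mem_ball_self hr)
  simpa [e.left_inv hw.1, e.left_inv hxe] using this

namespace IsConnectedIntegralSubmanifold

variable {E : Type} [NormedAddCommGroup E] [NormedSpace ℝ E] {U : Set E} {D : E → Submodule ℝ E}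
  {L : Set E}

theorem subset (hL : IsConnectedIntegralSubmanifold U D L) : L ⊆ U := by
  obtain ⟨n, S, _, _, ι, -, -, -, -, -, -, -, -, hU, rfl⟩ := hL
  rintro _ ⟨s, rfl⟩
  exact hU s

theorem isPreconnected (hL : IsConnectedIntegralSubmanifold U D L) : IsPreconnected L := by
  obtain ⟨n, S, _, _, ι, -, -, _, -, hι, -, -, -, -, rfl⟩ := hL
  exact isPreconnected_range hι.continuous

/-- A first integral of `D` is constant on connected integral submanifolds. -/
theorem eq_of_fderiv_eq_zero {F : Type*} [NormedAddCommGroup F] [NormedSpace ℝ F]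
    (hL : IsConnectedIntegralSubmanifold U D L) {f : E → F} (hf : Differentiable ℝ f)
    (h0 : ∀ a ∈ U, ∀ v ∈ D a, fderiv ℝ f a v = 0) {a b : E} (ha : a ∈ L) (hb : b ∈ L) :
    f a = f b := by
  obtain ⟨n, S, _, _, ι, -, -, _, _, hι, -, -, hrange, hU, rfl⟩ := hL
  obtain ⟨s, rfl⟩ := ha
  obtain ⟨t, rfl⟩ := hb
  have hι' : MDifferentiable (𝓡 n) 𝓘(ℝ, E) ι := hι.mdifferentiable (by simp)
  have hcomp (s : S) := (hf (ι s)).hasFDerivAt.hasMFDerivAt.comp s (hι' s).hasMFDerivAt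
  refine eq_of_mfderiv_eq_zero (g := f ∘ ι)
    (fun s => (hcomp s).mdifferentiableAt) (fun s => ?_) s t
  rw [(hcomp s).mfderiv]
  ext1 v
  have hv : mfderiv (𝓡 n) 𝓘(ℝ, E) ι s v ∈ (D (ι s) : Set E) := by
    rw [← hrange]
    exact mem_range_self v
  exact h0 _ (hU s) _ hv

end IsConnectedIntegralSubmanifold

/-! ### Vector algebra in `su(2)`: the form and the triple product in coordinates. -/

theorem form_eq (c : ℝ) (x y : su2) : form c x y =
    -8 * c * (coord x 0 * coord y 0 + coord x 1 * coord y 1 + coord x 2 * coord y 2) := by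
  simp only [form, LinearMap.smul_apply, killingForm_eq, smul_eq_mul]
  ring

theorem form_comm (c : ℝ) (x y : su2) : form c x y = form c y x := by
  rw [form_eq, form_eq]; ring

theorem form_lie_eq (c : ℝ) (x y z : su2) : form c x ⁅y, z⁆ = -16 * c *
    (coord x 0 * (coord y 1 * coord z 2 - coord y 2 * coord z 1) +
      coord x 1 * (coord y 2 * coord z 0 - coord y 0 * coord z 2) +
      coord x 2 * (coord y 0 * coord z 1 - coord y 1 * coord z 0)) := by
  rw [form_eq, coord_lie]
  simp
  ring

theorem form_lie_cycl (c : ℝ) (x y z : su2) : form c x ⁅y, z⁆ = form c y ⁅z, x⁆ := by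
  rw [form_lie_eq, form_lie_eq]; ring

theorem form_lie_self_left (c : ℝ) (x y : su2) : form c x ⁅x, y⁆ = 0 := by
  rw [form_lie_eq]; ring

theorem form_lie_self_right (c : ℝ) (x y : su2) : form c x ⁅y, x⁆ = 0 := by
  rw [form_lie_eq]; ring

theorem lieForm_apply (c : ℝ) (x ξ ζ : su2) : lieForm c x ξ ζ = form c ξ ⁅ζ, x⁆ := by
  rw [form_lie_cycl, form_lie_cycl, form_comm]
  rfl

theorem Phi_eq (c : ℝ) (a : Triple) : Phi c a = -16 * c *
    (coord (a 0) 0 * (coord (a 1) 1 * coord (a 2) 2 - coord (a 1) 2 * coord (a 2) 1) +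
      coord (a 0) 1 * (coord (a 1) 2 * coord (a 2) 0 - coord (a 1) 0 * coord (a 2) 2) +
      coord (a 0) 2 * (coord (a 1) 0 * coord (a 2) 1 - coord (a 1) 1 * coord (a 2) 0)) :=
  form_lie_eq c _ _ _

theorem Phi_cycl (c : ℝ) (a : Triple) : form c (a 1) ⁅a 2, a 0⁆ = Phi c a :=
  (form_lie_cycl c _ _ _).symm

theorem Phi_cycl' (c : ℝ) (a : Triple) : form c (a 2) ⁅a 0, a 1⁆ = Phi c a :=
  form_lie_cycl c _ _ _

/-- Two of the three squares vanish because `⟨x, [x, y]⟩ = 0`; the third contributes a factor `Φ`,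
which cancels the `Φ⁻¹` in the tensor. The same happens for the other two entries of `a`. -/
theorem tensorA_apply_zero {c : ℝ} {a : Triple} (h : Phi c a ≠ 0) (ξ : su2) :
    tensorA c a ξ (a 0) = form c ξ ⁅a 1, a 2⁆ := by
  simp only [tensorA, sqForm, LinearMap.smul_apply, LinearMap.add_apply,
    LinearMap.BilinForm.linMulLin_apply, smul_eq_mul, form_comm c ⁅a _, a _⁆, form_lie_self_left,
    form_lie_self_right]
  rw [← Phi]
  field_simp
  ring

theorem tensorA_apply_one {c : ℝ} {a : Triple} (h : Phi c a ≠ 0) (ξ : su2) :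
    tensorA c a ξ (a 1) = form c ξ ⁅a 2, a 0⁆ := by
  simp only [tensorA, sqForm, LinearMap.smul_apply, LinearMap.add_apply,
    LinearMap.BilinForm.linMulLin_apply, smul_eq_mul, form_comm c ⁅a _, a _⁆, form_lie_self_left,
    form_lie_self_right, Phi_cycl]
  field_simp
  ring

theorem tensorA_apply_two {c : ℝ} {a : Triple} (h : Phi c a ≠ 0) (ξ : su2) :
    tensorA c a ξ (a 2) = form c ξ ⁅a 0, a 1⁆ := by
  simp only [tensorA, sqForm, LinearMap.smul_apply, LinearMap.add_apply,
    LinearMap.BilinForm.linMulLin_apply, smul_eq_mul, form_comm c ⁅a _, a _⁆, form_lie_self_left,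
    form_lie_self_right, Phi_cycl']
  field_simp
  ring

/-- Cramer's rule in `su(2)`. -/
theorem Phi_smul_eq (c : ℝ) (a : Triple) (x : su2) : Phi c a • x =
    form c x ⁅a 1, a 2⁆ • a 0 + form c x ⁅a 2, a 0⁆ • a 1 + form c x ⁅a 0, a 1⁆ • a 2 := by
  apply coord.injective
  simp only [Phi_eq, form_lie_eq]
  ext i
  fin_cases i <;> simp <;> ring

/-- Linear functionals on `su(2)` that agree on a basis are equal. -/
theorem dual_ext {c : ℝ} {a : Triple} (h : Phi c a ≠ 0) {φ ψ : Module.Dual ℝ su2}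
    (hφ : ∀ i, φ (a i) = ψ (a i)) : φ = ψ := by
  ext x
  have h1 : Phi c a * φ x = Phi c a * ψ x := by
    rw [← smul_eq_mul, ← map_smul, ← smul_eq_mul, ← map_smul, Phi_smul_eq]
    simp [hφ]
  exact mul_left_cancel₀ h h1

/-- The `j`-th component of a covector represents its restriction to the `j`-th summand. -/
theorem linFun_grad {c : ℝ} (hc : c ≠ 0) (j : Fin 3) (β : Module.Dual ℝ Triple) (x : su2) :
    form c (grad c j β) x = β (Pi.single j x) := by
  simp only [grad, form, LinearMap.smul_apply, LinearMap.comp_apply, LinearEquiv.coe_coe, map_smul]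
  rw [smul_smul, inv_mul_cancel₀ hc, one_smul]
  exact LinearMap.BilinForm.apply_toDual_symm_apply
    (hB := LieAlgebra.IsKilling.killingForm_nondegenerate ℝ su2) _ _

/-- A covector is the sum of the differentials of the functions `l^j` of its components. -/
theorem dual_triple_apply {c : ℝ} (hc : c ≠ 0) (β : Module.Dual ℝ Triple) (v : Triple) :
    β v = ∑ k, form c (grad c k β) (v k) := by
  simp only [linFun_grad hc]
  rw [← map_sum, Finset.univ_sum_single]

/-! ### The distribution of `π₁` is the kernel of `df`. -/

/-- Membership in the distribution of `π₁`, in terms of pairings with the basis `a`. -/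
theorem mem_sympDistribution_iff {c : ℝ} (hc : c ≠ 0) {a : Triple} (h : Phi c a ≠ 0)
    (v : Triple) : v ∈ sympDistribution (pi1 c) a ↔
      ∃ ξ : Fin 3 → su2, ∀ k i, form c (a i) (v k) = ∑ j, bracketTable c a j k (ξ j) (a i) := by
  have hpi (α : Module.Dual ℝ Triple) (k : Fin 3) (ζ : su2) :
      pi1 c a α (linFun c k ζ) = ∑ j, bracketTable c a j k (grad c j α) ζ := by
    simp only [pi1, LinearMap.sum_apply, LinearMap.BilinForm.comp_apply, grad_linFun hc]
    refine Finset.sum_congr rfl fun j _ => ?_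
    rw [Finset.sum_eq_single k (by intro i _ h; simp [h]) (by simp)]
    simp
  simp only [sympDistribution, Submodule.mem_comap, LinearMap.mem_range]
  constructor
  · rintro ⟨α, hα⟩
    refine ⟨fun j => grad c j α, fun k i => ?_⟩
    rw [← hpi, hα]
    rfl
  · rintro ⟨ξ, hξ⟩
    have hgrad (j : Fin 3) : grad c j (∑ k, linFun c k (ξ k)) = ξ j := by
      rw [map_sum]
      simp [grad_linFun hc]
    refine ⟨∑ k, linFun c k (ξ k), LinearMap.ext fun β => ?_⟩
    have hk (k : Fin 3) : form c (v k) = ∑ j, bracketTable c a j k (ξ j) :=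
      dual_ext h fun i => by rw [form_comm, hξ, LinearMap.sum_apply]
    rw [Module.Dual.eval_apply, dual_triple_apply hc]
    simp only [pi1, LinearMap.sum_apply, LinearMap.BilinForm.comp_apply, hgrad]
    rw [Finset.sum_comm]
    refine Finset.sum_congr rfl fun k _ => ?_
    rw [form_comm, hk, LinearMap.sum_apply]

/-- The derivative of the Casimir map at `a` in the direction `v`. -/
def casimirDeriv (c : ℝ) (a v : Triple) : Fin 5 → ℝ :=
  ![form c (a 0) (v 1) + form c (a 1) (v 0), form c (a 1) (v 2) + form c (a 2) (v 1),
    form c (a 2) (v 0) + form c (a 0) (v 2), 2 * form c (a 0) (v 0) - 2 * form c (a 1) (v 1),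
    2 * form c (a 1) (v 1) - 2 * form c (a 2) (v 2)]

theorem casimirDeriv_eq_zero_iff (c : ℝ) (a v : Triple) : casimirDeriv c a v = 0 ↔
    form c (a 0) (v 1) + form c (a 1) (v 0) = 0 ∧ form c (a 1) (v 2) + form c (a 2) (v 1) = 0 ∧
    form c (a 2) (v 0) + form c (a 0) (v 2) = 0 ∧ form c (a 0) (v 0) = form c (a 1) (v 1) ∧
    form c (a 1) (v 1) = form c (a 2) (v 2) := by
  simp [casimirDeriv, funext_iff, Fin.forall_fin_succ, sub_eq_zero]

/-- Both sides say that the matrix `⟨a_i, v_k⟩` has skew off-diagonal part and constant diagonal. -/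
theorem mem_sympDistribution_iff_casimirDeriv {c : ℝ} (hc : c ≠ 0) {a : Triple}
    (h : Phi c a ≠ 0) (v : Triple) :
    v ∈ sympDistribution (pi1 c) a ↔ casimirDeriv c a v = 0 := by
  rw [mem_sympDistribution_iff hc h, casimirDeriv_eq_zero_iff]
  have s10 (x : su2) : form c x ⁅a 1, a 0⁆ = -form c x ⁅a 0, a 1⁆ := by
    rw [← lie_skew, map_neg]
  have s21 (x : su2) : form c x ⁅a 2, a 1⁆ = -form c x ⁅a 1, a 2⁆ := by
    rw [← lie_skew, map_neg]
  have s02 (x : su2) : form c x ⁅a 0, a 2⁆ = -form c x ⁅a 2, a 0⁆ := by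
    rw [← lie_skew, map_neg]
  have hsum (ξ : Fin 3 → su2) :
      (∀ k i, form c (a i) (v k) = ∑ j, bracketTable c a j k (ξ j) (a i)) ↔
      (form c (a 0) (v 0) = form c (ξ 1) ⁅a 0, a 1⁆ - form c (ξ 2) ⁅a 2, a 0⁆ ∧
       form c (a 1) (v 0) = - form c (ξ 0) ⁅a 0, a 1⁆ + form c (ξ 2) ⁅a 1, a 2⁆ ∧
       form c (a 2) (v 0) = form c (ξ 0) ⁅a 2, a 0⁆ - form c (ξ 1) ⁅a 1, a 2⁆ ∧
       form c (a 0) (v 1) = form c (ξ 0) ⁅a 0, a 1⁆ - form c (ξ 2) ⁅a 1, a 2⁆ ∧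
       form c (a 1) (v 1) = form c (ξ 1) ⁅a 0, a 1⁆ - form c (ξ 2) ⁅a 2, a 0⁆ ∧
       form c (a 2) (v 1) = -form c (ξ 0) ⁅a 1, a 2⁆ - form c (ξ 1) ⁅a 2, a 0⁆
         - form c (ξ 2) ⁅a 0, a 1⁆ ∧
       form c (a 0) (v 2) = -form c (ξ 0) ⁅a 2, a 0⁆ + form c (ξ 1) ⁅a 1, a 2⁆ ∧
       form c (a 1) (v 2) = form c (ξ 0) ⁅a 1, a 2⁆ + form c (ξ 1) ⁅a 2, a 0⁆
         + form c (ξ 2) ⁅a 0, a 1⁆ ∧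
       form c (a 2) (v 2) = form c (ξ 1) ⁅a 0, a 1⁆ - form c (ξ 2) ⁅a 2, a 0⁆) := by
    simp [Fin.forall_fin_succ, Fin.sum_univ_three, bracketTable, lieForm_apply,
      tensorA_apply_zero h, tensorA_apply_one h, tensorA_apply_two h, s10, s21, s02, and_assoc,
      sub_eq_add_neg]
  simp only [hsum]
  constructor
  · rintro ⟨ξ, h1, h2, h3, h4, h5, h6, h7, h8, h9⟩
    refine ⟨?_, ?_, ?_, ?_, ?_⟩ <;> linarith
  · rintro ⟨e1, e2, e3, e4, e5⟩
    -- Up to the factor `Φ`, the three brackets form the basis dual to `a`.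
    have hsolve (p q r : ℝ) : ∃ ξ : su2, form c ξ ⁅a 1, a 2⁆ = p ∧ form c ξ ⁅a 2, a 0⁆ = q ∧
        form c ξ ⁅a 0, a 1⁆ = r := by
      refine ⟨(Phi c a)⁻¹ • (p • a 0 + q • a 1 + r • a 2), ?_⟩
      simp only [map_add, map_smul, LinearMap.add_apply, LinearMap.smul_apply, smul_eq_mul,
        form_lie_self_left, form_lie_self_right, Phi_cycl, Phi_cycl']
      rw [← Phi]
      refine ⟨?_, ?_, ?_⟩ <;> field_simp <;> ring
    -- `ξ` produces the skew part and `ζ` the common diagonal value, so the third component of the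
    -- covector can be zero.
    obtain ⟨ξ, h1, h2, h3⟩ := hsolve (-form c (a 2) (v 1)) (form c (a 2) (v 0))
      (-form c (a 1) (v 0))
    obtain ⟨ζ, k1, k2, k3⟩ := hsolve 0 0 (form c (a 0) (v 0))
    refine ⟨![ξ, ζ, 0], ?_⟩
    simp [h1, h2, h3, k1, k2, k3]
    refine ⟨?_, ?_, ?_, ?_, ?_⟩ <;> linarith

/-- The nine pairings `⟨a_i, v_k⟩` can be prescribed freely, and the five components are independent
combinations of them. -/
theorem casimirDeriv_surjective {c : ℝ} {a : Triple} (h : Phi c a ≠ 0) :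
    Function.Surjective (casimirDeriv c a) := by
  have hsolve (p q r : ℝ) : ∃ x : su2, form c (a 0) x = p ∧ form c (a 1) x = q ∧
      form c (a 2) x = r := by
    refine ⟨(Phi c a)⁻¹ • (p • ⁅a 1, a 2⁆ + q • ⁅a 2, a 0⁆ + r • ⁅a 0, a 1⁆), ?_⟩
    simp only [map_add, map_smul, smul_eq_mul,
      form_lie_self_left, form_lie_self_right, Phi_cycl, Phi_cycl']
    rw [← Phi]
    refine ⟨?_, ?_, ?_⟩ <;> field_simp <;> ring
  intro w
  -- The diagonal is normalized to end in `0`; its doubled successive differences must be `w 3` and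
  -- `w 4`. One entry of each off-diagonal pair is set to `0`.
  obtain ⟨x, x0, x1, x2⟩ := hsolve ((w 3 + w 4) / 2) 0 (w 2)
  obtain ⟨y, y0, y1, y2⟩ := hsolve (w 0) (w 4 / 2) 0
  obtain ⟨z, z0, z1, z2⟩ := hsolve 0 (w 1) 0
  refine ⟨![x, y, z], ?_⟩
  ext i
  fin_cases i <;> simp [casimirDeriv, *] <;> ring

/-! ### Smoothness and derivative of the Casimir map. -/

theorem contDiff_linearMap {E : Type*} [NormedAddCommGroup E] [NormedSpace ℝ E]
    [FiniteDimensional ℝ E] (φ : E →ₗ[ℝ] ℝ) : ContDiff ℝ ∞ φ :=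
  (LinearMap.toContinuousLinearMap φ).contDiff

theorem hasDerivAt_comp_line {E F : Type*} [NormedAddCommGroup E] [NormedSpace ℝ E]
    [NormedAddCommGroup F] [NormedSpace ℝ F] {f : E → F} {a : E} (hf : DifferentiableAt ℝ f a)
    (v : E) : HasDerivAt (fun t : ℝ => f (a + t • v)) (fderiv ℝ f a v) 0 := by
  have h1 : HasDerivAt (fun t : ℝ => a + t • v) v 0 := by
    simpa using ((hasDerivAt_id (0 : ℝ)).smul_const v).const_add a
  have hd : HasFDerivAt f (fderiv ℝ f a) (a + (0 : ℝ) • v) := by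
    rw [zero_smul, add_zero]
    exact hf.hasFDerivAt
  exact hd.comp_hasDerivAt 0 h1

instance : FiniteDimensional ℝ Triple := Module.Finite.pi

theorem contDiff_coord (i k : Fin 3) : ContDiff ℝ ∞ fun a : Triple => coord (a i) k :=
  contDiff_linearMap (E := Triple)
    (LinearMap.proj k ∘ₗ coord.toLinearMap ∘ₗ LinearMap.proj i : Triple →ₗ[ℝ] ℝ)

theorem contDiff_form (c : ℝ) (i j : Fin 3) :
    ContDiff ℝ ∞ fun a : Triple => form c (a i) (a j) := by
  simp only [form_eq]
  have := contDiff_coord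
  fun_prop

theorem contDiff_casimir (c : ℝ) : ContDiff ℝ ∞ (casimir c) := by
  have := contDiff_form c
  rw [contDiff_pi]
  intro i
  fin_cases i <;> simp [casimir] <;> fun_prop

theorem continuous_Phi (c : ℝ) : Continuous (Phi c) := by
  have (i k : Fin 3) := (contDiff_coord i k).continuous
  rw [funext (Phi_eq c)]
  fun_prop

/-- The map is quadratic, so along a line it is a polynomial of degree two in `t` whose linear
coefficient is the derivative. -/
theorem fderiv_casimir (c : ℝ) (a v : Triple) :
    fderiv ℝ (casimir c) a v = casimirDeriv c a v := by
  have h2 : HasDerivAt (fun t : ℝ => casimir c (a + t • v)) (fderiv ℝ (casimir c) a v) 0 :=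
    hasDerivAt_comp_line ((contDiff_casimir c).differentiable (by simp) a) v
  have h3 : (fun t : ℝ => casimir c (a + t • v)) =
      fun t => casimir c a + (t • casimirDeriv c a v + t ^ 2 • casimir c v) := by
    funext t i
    fin_cases i <;> simp [casimir, casimirDeriv, form_eq] <;> ring
  have h4 : HasDerivAt (fun t : ℝ => casimir c (a + t • v)) (casimirDeriv c a v) 0 := by
    rw [h3]
    simpa using (((hasDerivAt_id (0 : ℝ)).smul_const (casimirDeriv c a v)).add
      (((hasDerivAt_id (0 : ℝ)).pow 2).smul_const (casimir c v))).const_add (casimir c a)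
  exact h2.unique h4

theorem finrank_triple : Module.finrank ℝ Triple = 9 := by
  simp [Module.finrank_pi_fintype, LinearEquiv.finrank_eq coord]

/-! ### Rotations and Euler angles. -/

open Matrix

theorem exists_polar (x y : ℝ) :
    ∃ r θ : ℝ, 0 ≤ r ∧ x = r * Real.cos θ ∧ y = r * Real.sin θ :=
  ⟨‖(⟨x, y⟩ : ℂ)‖, Complex.arg ⟨x, y⟩, norm_nonneg _, (Complex.norm_mul_cos_arg ⟨x, y⟩).symm,
    (Complex.norm_mul_sin_arg ⟨x, y⟩).symm⟩

/-- Rotation about the third axis. -/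
def rotZ (t : ℝ) : Matrix (Fin 3) (Fin 3) ℝ :=
  !![Real.cos t, -Real.sin t, 0; Real.sin t, Real.cos t, 0; 0, 0, 1]

/-- Rotation about the first axis. -/
def rotX (t : ℝ) : Matrix (Fin 3) (Fin 3) ℝ :=
  !![1, 0, 0; 0, Real.cos t, -Real.sin t; 0, Real.sin t, Real.cos t]

theorem rotZ_mul_transpose (t : ℝ) : rotZ t * (rotZ t)ᵀ = 1 := by
  have h := Real.sin_sq_add_cos_sq t
  ext i j
  fin_cases i <;> fin_cases j <;> simp [rotZ, Matrix.mul_apply, Fin.sum_univ_three] <;> linarith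

theorem rotX_mul_transpose (t : ℝ) : rotX t * (rotX t)ᵀ = 1 := by
  have h := Real.sin_sq_add_cos_sq t
  ext i j
  fin_cases i <;> fin_cases j <;> simp [rotX, Matrix.mul_apply, Fin.sum_univ_three] <;> linarith

theorem det_rotZ (t : ℝ) : (rotZ t).det = 1 := by
  have h := Real.sin_sq_add_cos_sq t
  simp [rotZ, Matrix.det_fin_three]; linarith

theorem det_rotX (t : ℝ) : (rotX t).det = 1 := by
  have h := Real.sin_sq_add_cos_sq t
  simp [rotX, Matrix.det_fin_three]; linarith

/-- A rotation fixing the third axis. -/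
theorem exists_rotZ_eq {Q : Matrix (Fin 3) (Fin 3) ℝ} (hQ : Q * Qᵀ = 1) (hdet : Q.det = 1)
    (h0 : Q 0 2 = 0) (h1 : Q 1 2 = 0) (h2 : Q 2 2 = 1) : ∃ t, Q = rotZ t := by
  have e (i j) := congrFun (congrFun hQ i) j
  have e22 := e 2 2
  have e00 := e 0 0
  have e11 := e 1 1
  simp [Matrix.mul_apply, Fin.sum_univ_three, h0, h1, h2] at e22 e00 e11
  have h20 : Q 2 0 = 0 := by nlinarith
  have h21 : Q 2 1 = 0 := by nlinarith
  rw [Matrix.det_fin_three] at hdet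
  simp [h0, h1, h2, h20, h21] at hdet
  -- The left side is the sum of the two squared row norms minus twice the determinant, that is `1 +
  -- 1 - 2`.
  have hz : (Q 0 1 + Q 1 0) ^ 2 + (Q 0 0 - Q 1 1) ^ 2 = 0 := by nlinarith
  have h01 : Q 0 1 = -Q 1 0 := by nlinarith [sq_nonneg (Q 0 1 + Q 1 0), sq_nonneg (Q 0 0 - Q 1 1)]
  have h11 : Q 1 1 = Q 0 0 := by nlinarith [sq_nonneg (Q 0 1 + Q 1 0), sq_nonneg (Q 0 0 - Q 1 1)]
  obtain ⟨r, t, hr, hx, hy⟩ := exists_polar (Q 0 0) (Q 1 0)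
  have hr1 : r = 1 := by
    have : r ^ 2 = 1 := by
      rw [h01, hx, hy] at e00
      linear_combination e00 - r ^ 2 * Real.sin_sq_add_cos_sq t
    nlinarith
  subst hr1
  refine ⟨t, ?_⟩
  ext i j
  fin_cases i <;> fin_cases j <;> simp [rotZ, *] at *

/-- Euler angles. -/
theorem exists_euler_angles {R : Matrix (Fin 3) (Fin 3) ℝ} (hR : R * Rᵀ = 1) (hdet : R.det = 1) :
    ∃ a b t, R = rotZ a * rotX b * rotZ t := by
  -- The angles are chosen so that `rotZ a * rotX b` has the third column of `R`, namely `(sin a sin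
  -- b, -cos a sin b, cos b)`; the remaining factor then fixes the third axis.
  obtain ⟨r, a, hr, hy, hx⟩ := exists_polar (-R 1 2) (R 0 2)
  obtain ⟨ρ, b, hρ, hz, hrb⟩ := exists_polar (R 2 2) r
  have hR' : Rᵀ * R = 1 := mul_eq_one_comm.mp hR
  have e := congrFun (congrFun hR' 2) 2
  simp [Matrix.mul_apply, Fin.sum_univ_three] at e
  have ha := Real.sin_sq_add_cos_sq a
  have hb := Real.sin_sq_add_cos_sq b
  have hy' : R 1 2 = -(r * Real.cos a) := by linarith
  have hρ1 : ρ = 1 := by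
    have h1 : r ^ 2 + R 2 2 ^ 2 = 1 := by
      rw [hx, hy'] at e
      linear_combination e - r ^ 2 * ha
    have : ρ ^ 2 = 1 := by
      rw [hrb, hz] at h1
      linear_combination h1 - ρ ^ 2 * hb
    nlinarith
  subst hρ1
  rw [one_mul] at hz hrb
  have hP : (rotZ a * rotX b) * (rotZ a * rotX b)ᵀ = 1 := by
    rw [transpose_mul, Matrix.mul_assoc, ← Matrix.mul_assoc (rotX b), rotX_mul_transpose,
      Matrix.one_mul, rotZ_mul_transpose]
  have hP' : (rotZ a * rotX b)ᵀ * (rotZ a * rotX b) = 1 := mul_eq_one_comm.mp hP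
  obtain ⟨t, ht⟩ : ∃ t, (rotZ a * rotX b)ᵀ * R = rotZ t := by
    apply exists_rotZ_eq
    · rw [transpose_mul _ R, transpose_transpose, Matrix.mul_assoc, ← Matrix.mul_assoc R, hR,
        Matrix.one_mul, hP']
    · rw [det_mul, det_transpose, det_mul, det_rotZ, det_rotX, hdet]; norm_num
    · simp [rotZ, rotX, Matrix.mul_apply, Fin.sum_univ_three, hx, hy']
      ring
    · simp [rotZ, rotX, Matrix.mul_apply, Fin.sum_univ_three, hx, hy', hz, hrb]
      linear_combination (-Real.sin b * Real.cos b) * ha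
    · simp [rotZ, rotX, Matrix.mul_apply, Fin.sum_univ_three, hx, hy', hz, hrb]
      linear_combination (Real.sin b ^ 2) * ha + hb
  exact ⟨a, b, t, by rw [← ht, ← Matrix.mul_assoc, hP, Matrix.one_mul]⟩

/-! ### Polar decomposition and connectedness for a prescribed Gram matrix. -/

theorem exists_orthogonal_diagonalization {n : Type*} [Fintype n] [DecidableEq n]
    {G : Matrix n n ℝ} (hG : Gᵀ = G) : ∃ (Q : Matrix n n ℝ) (l : n → ℝ),
      Qᵀ * Q = 1 ∧ Q * Qᵀ = 1 ∧ G = Q * diagonal l * Qᵀ := by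
  have hH : G.IsHermitian := by
    rw [Matrix.IsHermitian, conjTranspose_eq_transpose_of_trivial, hG]
  refine ⟨hH.eigenvectorUnitary, hH.eigenvalues, ?_, ?_, ?_⟩
  · have := Unitary.coe_star_mul_self hH.eigenvectorUnitary
    rwa [star_eq_conjTranspose, conjTranspose_eq_transpose_of_trivial] at this
  · have := Unitary.coe_mul_star_self hH.eigenvectorUnitary
    rwa [Unitary.coe_star, star_eq_conjTranspose, conjTranspose_eq_transpose_of_trivial] at this
  · have := hH.spectral_theorem
    rw [Unitary.conjStarAlgAut_apply, star_eq_conjTranspose,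
      conjTranspose_eq_transpose_of_trivial] at this
    exact this

theorem conj_diagonal_mul {n : Type*} [Fintype n] [DecidableEq n] {Q : Matrix n n ℝ}
    (hQ : Qᵀ * Q = 1) (d e : n → ℝ) : Q * diagonal d * Qᵀ * (Q * diagonal e * Qᵀ) =
      Q * diagonal (fun i => d i * e i) * Qᵀ := by
  rw [← diagonal_mul_diagonal]
  calc _ = Q * diagonal d * (Qᵀ * Q) * diagonal e * Qᵀ := by simp only [Matrix.mul_assoc]
    _ = _ := by rw [hQ, Matrix.mul_one]; simp only [Matrix.mul_assoc]

theorem conj_diagonal_transpose {n : Type*} [Fintype n] [DecidableEq n] (Q : Matrix n n ℝ)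
    (d : n → ℝ) : (Q * diagonal d * Qᵀ)ᵀ = Q * diagonal d * Qᵀ := by
  simp [transpose_mul, Matrix.mul_assoc]

theorem conj_diagonal_det {n : Type*} [Fintype n] [DecidableEq n] {Q : Matrix n n ℝ}
    (hQ : Qᵀ * Q = 1) (d : n → ℝ) : (Q * diagonal d * Qᵀ).det = ∏ i, d i := by
  have h : Q.det * Q.det = 1 := by
    have := congrArg det hQ
    rwa [det_mul, det_transpose, det_one] at this
  rw [det_mul, det_mul, det_transpose, det_diagonal]
  linear_combination (∏ i, d i) * h

/-- The matrices with positive determinant whose Gram matrix is prescribed up to a multiple of the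
identity form a connected set. -/
theorem isPreconnected_gram {G : Matrix (Fin 3) (Fin 3) ℝ} (hG : Gᵀ = G) :
    IsPreconnected {M : Matrix (Fin 3) (Fin 3) ℝ |
      0 < M.det ∧ ∃ s : ℝ, M * Mᵀ = G + s • (1 : Matrix (Fin 3) (Fin 3) ℝ)} := by
  obtain ⟨Q, l, hQ, hQ', rfl⟩ := exists_orthogonal_diagonalization hG
  -- The same `Q` diagonalizes every shift, so the square root of `G + s` is explicit and continuous
  -- in `s`.
  have hshift (s : ℝ) : Q * diagonal l * Qᵀ + s • (1 : Matrix (Fin 3) (Fin 3) ℝ) =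
      Q * diagonal (fun i => l i + s) * Qᵀ := by
    have : diagonal (fun i => l i + s) = diagonal l + s • (1 : Matrix (Fin 3) (Fin 3) ℝ) := by
      rw [← diagonal_add, smul_one_eq_diagonal]
    rw [this, Matrix.mul_add, Matrix.add_mul, Matrix.mul_smul, Matrix.mul_one, Matrix.smul_mul, hQ']
  simp only [hshift]
  let P : Set (ℝ × ℝ × ℝ × ℝ) := {s : ℝ | ∀ i, 0 < l i + s} ×ˢ univ
  let Γ : ℝ × ℝ × ℝ × ℝ → Matrix (Fin 3) (Fin 3) ℝ := fun q =>
    Q * diagonal (fun i => √(l i + q.1)) * Qᵀ * (rotZ q.2.1 * rotX q.2.2.1 * rotZ q.2.2.2)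
  have hrotZ : Continuous rotZ := by
    refine continuous_matrix fun i j => ?_
    fin_cases i <;> fin_cases j <;> simp [rotZ] <;> fun_prop
  have hrotX : Continuous rotX := by
    refine continuous_matrix fun i j => ?_
    fin_cases i <;> fin_cases j <;> simp [rotX] <;> fun_prop
  have hΓ : Continuous Γ := by
    have hd : Continuous fun q : ℝ × ℝ × ℝ × ℝ =>
        (diagonal (fun i => √(l i + q.1)) : Matrix (Fin 3) (Fin 3) ℝ) :=
      Continuous.matrix_diagonal (by fun_prop)
    have h1 := hrotZ.comp (continuous_fst.comp (continuous_snd (X := ℝ) (Y := ℝ × ℝ × ℝ)))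
    have h2 := hrotX.comp (continuous_fst.comp
      (continuous_snd.comp (continuous_snd (X := ℝ) (Y := ℝ × ℝ × ℝ))))
    have h3 := hrotZ.comp (continuous_snd.comp
      (continuous_snd.comp (continuous_snd (X := ℝ) (Y := ℝ × ℝ × ℝ))))
    exact ((continuous_const.matrix_mul hd).matrix_mul continuous_const).matrix_mul
      ((h1.matrix_mul h2).matrix_mul h3)
  have hP : IsPreconnected P := by
    refine IsPreconnected.prod (Convex.isPreconnected ?_) isPreconnected_univ
    have : {s : ℝ | ∀ i, 0 < l i + s} = ⋂ i, Ioi (-l i) := by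
      ext s
      simp [neg_lt_iff_pos_add']
    rw [this]
    exact convex_iInter fun i => convex_Ioi _
  convert hP.image Γ hΓ.continuousOn
  ext M
  constructor
  · rintro ⟨hM, s, hs⟩
    -- The eigenvalues of `M Mᵀ` are nonnegative, and none vanishes since their product is `(det M)
    -- ^ 2`.
    have hpos : ∀ i, 0 < l i + s := by
      have hdet : ∏ i, (l i + s) ≠ 0 := by
        rw [← conj_diagonal_det hQ, ← hs, det_mul, det_transpose]
        positivity
      intro i
      refine lt_of_le_of_ne ?_ (Ne.symm (Finset.prod_ne_zero_iff.mp hdet i (Finset.mem_univ i)))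
      have h1 : (Qᵀ * M) * (Qᵀ * M)ᵀ = diagonal (fun i => l i + s) := by
        calc _ = Qᵀ * (M * Mᵀ) * Q := by simp [transpose_mul, Matrix.mul_assoc]
          _ = (Qᵀ * Q) * diagonal (fun i => l i + s) * (Qᵀ * Q) := by
            rw [hs]; simp only [Matrix.mul_assoc]
          _ = _ := by rw [hQ, Matrix.one_mul, Matrix.mul_one]
      have h2 := congrFun (congrFun h1 i) i
      rw [diagonal_apply_eq, mul_apply] at h2
      rw [← h2]
      exact Finset.sum_nonneg fun j _ => mul_self_nonneg _
    have hsq (i) : √(l i + s) ≠ 0 := (Real.sqrt_pos.mpr (hpos i)).ne'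
    have hone : Q * Matrix.diagonal (fun _ => (1 : ℝ)) * Qᵀ = 1 := by
      rw [diagonal_one, Matrix.mul_one, hQ']
    let B := Q * diagonal (fun i => √(l i + s)) * Qᵀ
    let B' := Q * diagonal (fun i => (√(l i + s))⁻¹) * Qᵀ
    have hBB' : B * B' = 1 := by
      simp only [B, B', conj_diagonal_mul hQ, mul_inv_cancel₀ (hsq _), hone]
    -- `B'` is the inverse of the square root of `M Mᵀ`, so `B' * M` is the orthogonal polar factor.
    have hR : (B' * M) * (B' * M)ᵀ = 1 := by
      have h1 : (B' * M) * (B' * M)ᵀ = B' * (M * Mᵀ) * B' := by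
        rw [transpose_mul, conj_diagonal_transpose]
        simp only [B', Matrix.mul_assoc]
      rw [h1, hs]
      simp only [B', conj_diagonal_mul hQ]
      rw [← hone]
      congr 3
      ext i
      have := Real.mul_self_sqrt (hpos i).le
      have := hsq i
      field_simp
      nlinarith
    have hB' : 0 < B'.det := by
      simp only [B', conj_diagonal_det hQ]
      exact Finset.prod_pos fun i _ => inv_pos.mpr (Real.sqrt_pos.mpr (hpos i))
    have hRdet : (B' * M).det = 1 := by
      have h1 := congrArg det hR
      rw [det_mul _ (B' * M)ᵀ, det_transpose, det_one] at h1
      have h2 : 0 < (B' * M).det := by rw [det_mul]; positivity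
      nlinarith
    obtain ⟨a, b, t, habt⟩ := exists_euler_angles hR hRdet
    refine ⟨(s, a, b, t), ⟨hpos, trivial⟩, ?_⟩
    change B * _ = M
    rw [← habt, ← Matrix.mul_assoc, hBB', Matrix.one_mul]
  · rintro ⟨⟨s, a, b, t⟩, ⟨hs, -⟩, rfl⟩
    have hs' : ∀ i, 0 < l i + s := hs
    refine ⟨?_, s, ?_⟩
    · simp only [Γ]
      rw [det_mul, conj_diagonal_det hQ, det_mul, det_mul, det_rotZ, det_rotX, det_rotZ]
      have := Finset.prod_pos fun i (_ : i ∈ Finset.univ) => Real.sqrt_pos.mpr (hs' i)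
      simpa using this
    · simp only [Γ]
      have hR : (rotZ a * rotX b * rotZ t) * (rotZ a * rotX b * rotZ t)ᵀ = 1 := by
        calc _ = rotZ a * (rotX b * (rotZ t * (rotZ t)ᵀ) * (rotX b)ᵀ) * (rotZ a)ᵀ := by
              simp only [transpose_mul, Matrix.mul_assoc]
          _ = 1 := by
            rw [rotZ_mul_transpose, Matrix.mul_one, rotX_mul_transpose, Matrix.mul_one,
              rotZ_mul_transpose]
      rw [transpose_mul, conj_diagonal_transpose, Matrix.mul_assoc,
        ← Matrix.mul_assoc (rotZ a * rotX b * rotZ t), hR, Matrix.one_mul, conj_diagonal_mul hQ]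
      congr 3
      ext i
      exact Real.mul_self_sqrt (hs' i).le

/-! ### From triples to matrices. -/

/-- The matrix whose rows are the coordinates of a triple. -/
def toMat (a : Triple) : Matrix (Fin 3) (Fin 3) ℝ := of fun i => coord (a i)

theorem Phi_eq_det (c : ℝ) (a : Triple) : Phi c a = -16 * c * (toMat a).det := by
  rw [Phi_eq, det_fin_three]
  simp only [toMat, of_apply]
  ring

theorem form_eq_gram (c : ℝ) (a : Triple) (i j : Fin 3) :
    form c (a i) (a j) = -8 * c * (toMat a * (toMat a)ᵀ) i j := by
  rw [form_eq, mul_apply, Fin.sum_univ_three]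
  rfl

/-- The off-diagonal entries and the differences of diagonal entries determine a symmetric matrix up
to a multiple of the identity. -/
theorem casimir_eq_iff {c : ℝ} (hc : c ≠ 0) (a b : Triple) : casimir c a = casimir c b ↔
    ∃ s : ℝ, toMat a * (toMat a)ᵀ = toMat b * (toMat b)ᵀ + s • (1 : Matrix (Fin 3) (Fin 3) ℝ) := by
  have hsymm (x : Triple) (i j) : (toMat x * (toMat x)ᵀ) i j = (toMat x * (toMat x)ᵀ) j i := by
    rw [← transpose_apply (toMat x * (toMat x)ᵀ) i j, transpose_mul, transpose_transpose]
  have h1 : casimir c a = casimir c b ↔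
      (toMat a * (toMat a)ᵀ) 0 1 = (toMat b * (toMat b)ᵀ) 0 1 ∧
      (toMat a * (toMat a)ᵀ) 1 2 = (toMat b * (toMat b)ᵀ) 1 2 ∧
      (toMat a * (toMat a)ᵀ) 2 0 = (toMat b * (toMat b)ᵀ) 2 0 ∧
      (toMat a * (toMat a)ᵀ) 0 0 - (toMat a * (toMat a)ᵀ) 1 1 =
        (toMat b * (toMat b)ᵀ) 0 0 - (toMat b * (toMat b)ᵀ) 1 1 ∧
      (toMat a * (toMat a)ᵀ) 1 1 - (toMat a * (toMat a)ᵀ) 2 2 =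
        (toMat b * (toMat b)ᵀ) 1 1 - (toMat b * (toMat b)ᵀ) 2 2 := by
    have hk : -8 * c ≠ 0 := mul_ne_zero (by norm_num) hc
    simp only [casimir, form_eq_gram, ← mul_sub, funext_iff, Fin.forall_fin_succ]
    simp only [cons_val_zero, cons_val_succ, mul_right_inj' hk]
    simp
  rw [h1]
  constructor
  · rintro ⟨e1, e2, e3, e4, e5⟩
    refine ⟨(toMat a * (toMat a)ᵀ) 0 0 - (toMat b * (toMat b)ᵀ) 0 0, ?_⟩
    ext i j
    fin_cases i <;> fin_cases j <;>
      simp only [Matrix.add_apply, Matrix.smul_apply, one_apply, smul_eq_mul, Fin.zero_eta,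
        Fin.mk_one, Fin.reduceFinMk, Fin.isValue, Fin.reduceEq, if_true, if_false, mul_one,
        mul_zero, add_zero, zero_ne_one, one_ne_zero] <;>
      linarith [hsymm a 0 1, hsymm a 1 2, hsymm a 2 0, hsymm b 0 1, hsymm b 1 2, hsymm b 2 0]
  · rintro ⟨s, hs⟩
    simp [hs]

theorem continuous_linearMap {E F : Type*} [NormedAddCommGroup E] [NormedSpace ℝ E]
    [FiniteDimensional ℝ E] [NormedAddCommGroup F] [NormedSpace ℝ F] (φ : E →ₗ[ℝ] F) :
    Continuous φ :=
  φ.continuous_of_finiteDimensional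

theorem continuous_coord_symm : Continuous coord.symm :=
  continuous_linearMap (F := su2) coord.symm.toLinearMap

/-- The condition `0 < Phi c a * Phi c η` treats both signs of `Φ` at once. -/
theorem isConnected_casimir_level {c : ℝ} (hc : c ≠ 0) {η : Triple} (hη : Phi c η ≠ 0) :
    IsConnected ({a | 0 < Phi c a * Phi c η} ∩ casimir c ⁻¹' {casimir c η}) := by
  refine ⟨⟨η, mul_self_pos.mpr hη, rfl⟩, ?_⟩
  -- In odd dimension `M ↦ -M` reverses the determinant and preserves the Gram matrix, which reduces
  -- to positive determinant.
  obtain ⟨ε, hε, hpos⟩ : ∃ ε : ℝ, ε * ε = 1 ∧ 0 < ε * (toMat η).det := by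
    have h : (toMat η).det ≠ 0 := fun h => hη (by rw [Phi_eq_det, h, mul_zero])
    rcases lt_or_gt_of_ne h with h | h
    · exact ⟨-1, by norm_num, by linarith⟩
    · exact ⟨1, by norm_num, by linarith⟩
  have hPhi (a : Triple) : 0 < Phi c a * Phi c η ↔ 0 < ε * (toMat a).det := by
    have h1 : Phi c a * Phi c η =
        (256 * c ^ 2 * (ε * (toMat η).det)) * (ε * (toMat a).det) := by
      rw [Phi_eq_det, Phi_eq_det]
      linear_combination (-256 * c ^ 2 * (toMat η).det * (toMat a).det) * hε
    rw [h1]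
    exact mul_pos_iff_of_pos_left (by positivity)
  have hsmul (M : Matrix (Fin 3) (Fin 3) ℝ) :
      (ε • M).det = ε * M.det ∧ (ε • M) * (ε • M)ᵀ = M * Mᵀ := by
    constructor
    · rw [det_smul, Fintype.card_fin]
      linear_combination (ε * M.det) * hε
    · rw [transpose_smul, smul_mul_smul_comm, hε, one_smul]
  let Γ : Matrix (Fin 3) (Fin 3) ℝ → Triple := fun M i => coord.symm (ε • M i)
  have hΓ : Continuous Γ :=
    continuous_pi fun i => continuous_coord_symm.comp ((continuous_apply i).const_smul ε)
  have hmat (M : Matrix (Fin 3) (Fin 3) ℝ) : toMat (Γ M) = ε • M := by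
    ext i j
    simp [toMat, Γ]
  have hG : (toMat η * (toMat η)ᵀ)ᵀ = toMat η * (toMat η)ᵀ := by simp
  convert (isPreconnected_gram hG).image Γ hΓ.continuousOn
  ext a
  simp only [mem_inter_iff, mem_ofPred_eq, mem_preimage, mem_singleton_iff, hPhi,
    casimir_eq_iff hc, mem_image]
  constructor
  · rintro ⟨h1, h2⟩
    refine ⟨ε • toMat a, ⟨by rwa [(hsmul _).1], by rwa [(hsmul _).2]⟩, ?_⟩
    funext i
    apply coord.injective
    ext j
    simp [Γ, toMat, ← mul_assoc, hε]
  · rintro ⟨M, ⟨h1, h2⟩, rfl⟩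
    rw [hmat, (hsmul _).1, (hsmul _).2, ← mul_assoc, hε, one_mul]
    exact ⟨h1, h2⟩

/-! ### The symplectic leaves. -/

theorem isConnectedIntegralSubmanifold_casimir_level {c : ℝ} (hc : c ≠ 0) {η : Triple}
    (hη : Phi c η ≠ 0) :
    IsConnectedIntegralSubmanifold (starSet c) (sympDistribution (pi1 c))
      ({a | 0 < Phi c a * Phi c η} ∩ casimir c ⁻¹' {casimir c η}) := by
  have hne {a : Triple} (ha : 0 < Phi c a * Phi c η) : Phi c a ≠ 0 :=
    left_ne_zero_of_mul ha.ne'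
  refine isConnectedIntegralSubmanifold_level (E := Triple) (n := 4) ?_ (contDiff_casimir c)
    (isOpen_lt continuous_const ((continuous_Phi c).mul_const _)) (fun a ha => hne ha) _
    (fun a ha w => ?_) _ (fun a ha v => ?_) (isConnected_casimir_level hc hη)
  · exact finrank_triple.trans (by simp)
  · obtain ⟨v, hv⟩ := casimirDeriv_surjective (hne ha) w
    exact ⟨v, (fderiv_casimir c a v).trans hv⟩
  · refine (mem_sympDistribution_iff_casimirDeriv hc (hne ha) v).trans ?_
    exact ⟨(fderiv_casimir c a v).trans, (fderiv_casimir c a v).symm.trans⟩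

/-- The Casimir map is constant, and `Φ` has constant sign, on connected integral submanifolds. -/
theorem IsConnectedIntegralSubmanifold.subset_casimir_level {c : ℝ} (hc : c ≠ 0)
    {L : Set Triple}
    (hL : IsConnectedIntegralSubmanifold (starSet c) (sympDistribution (pi1 c)) L)
    {b : Triple} (hb : b ∈ L) :
    L ⊆ {a | 0 < Phi c a * Phi c b} ∩ casimir c ⁻¹' {casimir c b} := by
  intro a ha
  constructor
  -- A change of sign would force a zero of `Φ` on the connected set `L`, which lies in `{Φ ≠ 0}`.
  · by_contra hneg
    obtain ⟨r, hr, hr0⟩ := hL.isPreconnected.intermediate_value ha hb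
      ((continuous_Phi c).mul_const (Phi c b)).continuousOn ⟨not_lt.mp hneg, mul_self_nonneg _⟩
    exact mul_ne_zero (hL.subset hr) (hL.subset hb) hr0
  · exact hL.eq_of_fderiv_eq_zero ((contDiff_casimir c).differentiable (by simp))
      (fun x hx v hv => (fderiv_casimir c x v).trans
        ((mem_sympDistribution_iff_casimirDeriv hc hx v).mp hv)) ha hb

/-- The level set is an integral submanifold and contains every connected one that meets it, so it
is a leaf; any leaf through `η` contains it by maximality and is contained in it by constancy of `f`
and of the sign of `Φ`. -/
theorem isSymplecticLeaf_iff {c : ℝ} (hc : c ≠ 0) {η : Triple} (hη : Phi c η ≠ 0)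
    (L : Set Triple) : (IsSymplecticLeaf (starSet c) (pi1 c) L ∧ η ∈ L) ↔
      L = {a | 0 < Phi c a * Phi c η} ∩ casimir c ⁻¹' {casimir c η} := by
  have hlevel := isConnectedIntegralSubmanifold_casimir_level hc hη
  have hmem : η ∈ {a | 0 < Phi c a * Phi c η} ∩ casimir c ⁻¹' {casimir c η} :=
    ⟨mul_self_pos.mpr hη, rfl⟩
  constructor
  · rintro ⟨⟨h1, h2⟩, h3⟩
    exact (h1.subset_casimir_level hc h3).antisymm (h2 _ hlevel ⟨η, hmem, h3⟩)
  · rintro rfl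
    refine ⟨⟨hlevel, ?_⟩, hmem⟩
    rintro L' hL' ⟨b, hbL', hb1, hb2⟩ a ha
    obtain ⟨ha1, ha2⟩ := hL'.subset_casimir_level hc hbL' ha
    refine ⟨?_, ha2.trans hb2⟩
    simp only [mem_ofPred_eq] at ha1 hb1 ⊢
    have h : 0 < (Phi c b * Phi c b) * (Phi c a * Phi c η) := by
      linarith [mul_pos ha1 hb1]
    exact pos_of_mul_pos_right h (mul_self_nonneg _)

end HyperLie

end

theorem theorem3p1 (c : ℝ) (hc : c ≠ 0) :
    (∀ η : HyperLie.Triple, 0 < HyperLie.Phi c η →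
      (∀ L : Set HyperLie.Triple,
        (HyperLie.IsSymplecticLeaf (HyperLie.starSet c) (HyperLie.pi1 c) L ∧ η ∈ L) ↔
          L = HyperLie.casimir c ⁻¹' {HyperLie.casimir c η} ∩ {a | 0 < HyperLie.Phi c a}) ∧
      IsConnected
        (HyperLie.casimir c ⁻¹' {HyperLie.casimir c η} ∩ {a | 0 < HyperLie.Phi c a})) ∧
    (∀ η : HyperLie.Triple, HyperLie.Phi c η < 0 →
      (∀ L : Set HyperLie.Triple,
        (HyperLie.IsSymplecticLeaf (HyperLie.starSet c) (HyperLie.pi1 c) L ∧ η ∈ L) ↔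
          L = HyperLie.casimir c ⁻¹' {HyperLie.casimir c η} ∩ {a | HyperLie.Phi c a < 0}) ∧
      IsConnected
        (HyperLie.casimir c ⁻¹' {HyperLie.casimir c η} ∩ {a | HyperLie.Phi c a < 0})) := by
  refine ⟨fun η hη => ?_, fun η hη => ?_⟩
  · have h : HyperLie.casimir c ⁻¹' {HyperLie.casimir c η} ∩ {a | 0 < HyperLie.Phi c a} =
        {a | 0 < HyperLie.Phi c a * HyperLie.Phi c η} ∩
          HyperLie.casimir c ⁻¹' {HyperLie.casimir c η} := by
      simp only [mul_pos_iff_of_pos_right hη, Set.inter_comm]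
    rw [h]
    exact ⟨HyperLie.isSymplecticLeaf_iff hc hη.ne', HyperLie.isConnected_casimir_level hc hη.ne'⟩
  · have h : HyperLie.casimir c ⁻¹' {HyperLie.casimir c η} ∩ {a | HyperLie.Phi c a < 0} =
        {a | 0 < HyperLie.Phi c a * HyperLie.Phi c η} ∩
          HyperLie.casimir c ⁻¹' {HyperLie.casimir c η} := by
      simp only [← neg_mul_neg (HyperLie.Phi c _) (HyperLie.Phi c η),
        mul_pos_iff_of_pos_right (neg_pos.mpr hη), neg_pos, Set.inter_comm]
    rw [h]
    exact ⟨HyperLie.isSymplecticLeaf_iff hc hη.ne, HyperLie.isConnected_casimir_level hc hη.ne⟩
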